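/- Let $0<q<1$, write $(a;q)_m=\prod_{j=0}^{m-1}(1-aq^j)$, and let $$\tilde p_n(x;\alpha,\beta|q)=(-1)^nq^{\binom n2}\frac{(\alpha q;q)_n}{(\alpha\beta q^{n+1};q)_n}\sum_{m=0}^{n}\frac{(q^{-n};q)_m(\alpha\beta q^{n+1};q)_m}{(\alpha q;q)_m(q;q)_m}(qx)^m$$ be the monic little $q$-Jacobi polynomial of degree $n$. Let $\alpha,\beta\in\mathbb R$ with $0<\alpha q<1$ and $0<\beta q<1$, and let $n\ge 1$; if $n=1$, assume in addition that $\alpha\beta q<1$. Then $\tilde p_n(x;\alpha,\beta|q)$ has $n$ real distinct zeros $x_{n,1}<\dots<x_{n,n}$, $\tilde p_{n-1}(x;\alpha,\beta|q)$ has $n-1$ real distinct zeros $x_{n-1,1}<\dots<x_{n-1,n-1}$, and the following hold. (i) If $\alpha>1$, then $\tilde p_n(x;\alpha/q,\beta|q)$ has degree $n$ and $n$ real distinct zeros $y_{n,1}<\dots<y_{n,n}$, and $$y_{n,1}<0<x_{n,1}<x_{n-1,1}<y_{n,2}<x_{n,2}<x_{n-1,2}<\cdots<x_{n-1,n-1}<y_{n,n}<x_{n,n}<1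 ,$$ that is, $y_{n,1}<0<x_{n,1}$, $y_{n,j}<x_{n,j}$ for $1\le j\le n$, $x_{n,j}<x_{n-1,j}<y_{n,j+1}$ for $1\le j\le n-1$, and $x_{n,n}<1$. (ii) If $\beta>1$, then $\tilde p_n(x;\alpha,\beta/q|q)$ has degree $n$ and $n$ real distinct zeros $z_{n,1}<\dots<z_{n,n}$, and $$0<x_{n,1}<z_{n,1}<x_{n-1,1}<x_{n,2}<z_{n,2}<x_{n-1,2}<\cdots<x_{n-1,n-1}<x_{n,n}<1<z_{n,n} ,$$ that is, $0<x_{n,1}$, $x_{n,j}<z_{n,j}$ for $1\le j\le n$, $z_{n,j}<x_{n-1,j}<x_{n,j+1}$ for $1\le j\le n-1$, and $x_{n,n}<1<z_{n,n}$. -/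

import Mathlib

open Polynomial

/-- The `q`-Pochhammer symbol `(a; q)_m = ∏_{j=0}^{m-1} (1 - a q^j)`. -/
def qPoch (a q : ℝ) (m : ℕ) : ℝ := ∏ j ∈ Finset.range m, (1 - a * q ^ j)

/-- The basic hypergeometric series `₂φ₁(a, b; c; q; z)`. -/
noncomputable def phi21 (a b c q z : ℝ) : ℝ :=
  ∑' m : ℕ, qPoch a q m * qPoch b q m / qPoch c q m * (z ^ m / qPoch q q m)

/-- The monic little `q`-Jacobi polynomial of degree `n`,
`(-1)^n q^(n choose 2) (αq; q)_n / (αβ q q^n; q)_n * ₂φ₁(q^(-n), αβ q^(n+1); αq; q; q x)`,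
as a polynomial in `x`.  The series stops at `m = n` because `(q^(-n); q)_m = 0` for `m > n`;
see `littleQJacobi_eval`. -/
noncomputable def littleQJacobi (q α β : ℝ) (n : ℕ) : ℝ[X] :=
  C ((-1) ^ n * q ^ n.choose 2 * qPoch (α * q) q n / qPoch (α * β * q * q ^ n) q n) *
    ∑ m ∈ Finset.range (n + 1),
      C (qPoch (q ^ n)⁻¹ q m * qPoch (α * β * q ^ (n + 1)) q m / qPoch (α * q) q m *
        (q ^ m / qPoch q q m)) * X ^ m

theorem littleQJacobi_eval (q α β : ℝ) (hq : q ≠ 0) (n : ℕ) (x : ℝ) :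
    (littleQJacobi q α β n).eval x =
      (-1) ^ n * q ^ n.choose 2 * qPoch (α * q) q n / qPoch (α * β * q * q ^ n) q n *
        phi21 (q ^ n)⁻¹ (α * β * q ^ (n + 1)) (α * q) q (q * x) := by
  unfold littleQJacobi phi21
  rw [tsum_eq_sum (s := Finset.range (n + 1))]
  · simp only [eval_mul, eval_C, eval_finsetSum, eval_pow, eval_X]
    congr 1
    refine Finset.sum_congr rfl fun m _ => ?_
    rw [mul_pow]
    ring
  · intro m hm
    have hnm : n < m := by
      rw [Finset.mem_range] at hm
      omega
    have h0 : qPoch (q ^ n)⁻¹ q m = 0 := by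
      refine Finset.prod_eq_zero (Finset.mem_range.2 hnm) ?_
      rw [inv_mul_cancel₀ (pow_ne_zero n hq), sub_self]
    rw [h0]
    simp

/-- `x 1 < x 2 < ⋯ < x n` are the zeros of the polynomial `p` of degree `n`: `p` has exactly `n`
(complex) zeros, they are real and distinct, and they are listed in increasing order.
Only the values `x 1, …, x n` matter. -/
structure AreOrderedZeros (p : ℝ[X]) (n : ℕ) (x : ℕ → ℝ) : Prop where
  natDegree_eq : p.natDegree = n
  strictMonoOn : StrictMonoOn x (Set.Icc 1 n)
  zero_iff : ∀ t : ℂ, aeval t p = 0 ↔ ∃ j ∈ Set.Icc 1 n, t = (x j : ℂ)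

/-!
Write `p (α, β) n` for the monic little `q`-Jacobi polynomials. Their explicit coefficients give
contiguous relations
`p (α, β) (n + 1) = p (α q, β) (n + 1) + C p (α q, β) n`,
`p (α, β) (n + 1) = p (α, β q) (n + 1) - E p (α, β q) n`,
`x p (α q, β) n = p (α, β) (n + 1) + A n p (α, β) n`.
Eliminating `α q` from the first and the last yields the three-term recurrence, together with the
ratios of consecutive values at `0` and at `1`; counting sign changes then shows that the zeros of
`p (α, β) n` and `p (α, β) (n + 1)` interlace and lie in `(0, 1)` when `α q, β q < 1`.

Raising `α` to `α / q` or `β` to `β / q` therefore adds to `p (n + 1)` a multiple of `p n`, of known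
sign. Such a perturbation keeps the zeros interlaced with those of `p n` and moves all of them to
one side. That the extreme zero even leaves `(0, 1)` is read off from the sign of the new polynomial
at `0`, respectively at `1`.
-/

section Zeros

variable {p r : ℝ[X]} {n : ℕ} {x w y : ℕ → ℝ}

/-- The points `w 1, …, w n` separate the points `x 1, …, x (n + 1)`. -/
def Interlaces (n : ℕ) (x w : ℕ → ℝ) : Prop :=
  ∀ j ∈ Set.Icc 1 n, x j < w j ∧ w j < x (j + 1)

theorem eq_prod_X_sub_C_of_strictMonoOn (hp : p.Monic) (hn : p.natDegree = n)
    (hx : StrictMonoOn x (Set.Icc 1 n)) (h0 : ∀ j ∈ Set.Icc 1 n, p.eval (x j) = 0) :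
    p = ∏ j ∈ Finset.Icc 1 n, (X - C (x j)) := by
  refine eq_of_monic_of_dvd_of_natDegree_le (monic_prod_X_sub_C _ _) hp ?_ ?_
  · refine Finset.prod_dvd_of_coprime (fun i hi j hj hij => ?_) fun i hi => ?_
    · refine isCoprime_X_sub_C_of_isUnit_sub (sub_ne_zero.2 fun h => hij ?_).isUnit
      exact hx.injOn (by simpa using hi) (by simpa using hj) h
    · exact dvd_iff_isRoot.2 (h0 i (by simpa using hi))
  · rw [natDegree_finsetProd_X_sub_C_eq_card, hn, Nat.card_Icc, Nat.add_sub_cancel]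

namespace AreOrderedZeros

theorem of_monic (hp : p.Monic) (hn : p.natDegree = n) (hx : StrictMonoOn x (Set.Icc 1 n))
    (h0 : ∀ j ∈ Set.Icc 1 n, p.eval (x j) = 0) : AreOrderedZeros p n x where
  natDegree_eq := hn
  strictMonoOn := hx
  zero_iff t := by
    rw [eq_prod_X_sub_C_of_strictMonoOn hp hn hx h0, map_prod, Finset.prod_eq_zero_iff]
    simp [sub_eq_zero]

theorem natDegree_lt (hp : AreOrderedZeros p (n + 1) x) (hr : AreOrderedZeros r n w) :
    r.natDegree < p.natDegree := by
  rw [hp.natDegree_eq, hr.natDegree_eq]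
  exact n.lt_succ_self

theorem eval_eq_zero (h : AreOrderedZeros p n x) {j : ℕ} (hj : j ∈ Set.Icc 1 n) :
    p.eval (x j) = 0 := by
  have hroot := (h.zero_iff (x j)).2 ⟨j, hj, rfl⟩
  rw [← Complex.coe_algebraMap, aeval_algebraMap_apply, Complex.coe_algebraMap,
    Complex.ofReal_eq_zero] at hroot
  simpa using hroot

theorem eval_eq_prod (h : AreOrderedZeros p n x) (hp : p.Monic) (t : ℝ) :
    p.eval t = ∏ j ∈ Finset.Icc 1 n, (t - x j) := by
  conv_lhs => rw [eq_prod_X_sub_C_of_strictMonoOn hp h.natDegree_eq h.strictMonoOn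
    fun j hj => h.eval_eq_zero hj]
  simp [eval_prod]

/-- The exponent `n + j` has the parity of `n - j`, the number of zeros above `t`. -/
theorem eval_sign (h : AreOrderedZeros p n x) (hp : p.Monic) {j : ℕ} (hj : j ≤ n) {t : ℝ}
    (hl : 1 ≤ j → x j < t) (hu : j < n → t < x (j + 1)) : 0 < (-1) ^ (n + j) * p.eval t := by
  have hmono := h.strictMonoOn.monotoneOn
  have hparity : (-1 : ℝ) ^ (n + j) = ∏ i ∈ Finset.Icc 1 n with ¬ i ≤ j, (-1) := by
    have hfilter : (Finset.Icc 1 n).filter (¬ · ≤ j) = Finset.Ioc j n := by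
      ext i
      simp only [Finset.mem_filter, Finset.mem_Icc, Finset.mem_Ioc]
      omega
    rw [hfilter, Finset.prod_const, Nat.card_Ioc, show n + j = n - j + 2 * j by omega, pow_add,
      pow_mul, neg_one_sq, one_pow, mul_one]
  rw [h.eval_eq_prod hp, hparity,
    ← Finset.prod_filter_mul_prod_filter_not (Finset.Icc 1 n) (· ≤ j) (fun i => t - x i),
    mul_left_comm, ← Finset.prod_mul_distrib]
  refine mul_pos (Finset.prod_pos fun i hi => ?_) (Finset.prod_pos fun i hi => ?_)
  all_goals simp only [Finset.mem_filter, Finset.mem_Icc] at hi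
  · have hxi : x i ≤ x j := hmono ⟨hi.1.1, hi.1.2⟩ ⟨hi.1.1.trans hi.2, hj⟩ hi.2
    have hxt := hl (by omega)
    linarith
  · have hxi : x (j + 1) ≤ x i := hmono ⟨by omega, by omega⟩ ⟨hi.1.1, hi.1.2⟩ (by omega)
    have htx := hu (by omega)
    linarith

theorem lt_iff_eval_pos (h : AreOrderedZeros p (n + 1) x) (hp : p.Monic) {j : ℕ} (hj : j ≤ n)
    {t : ℝ} (hl : 1 ≤ j → x j < t) (hu : j < n → t < x (j + 2)) :
    x (j + 1) < t ↔ 0 < (-1) ^ (n + j) * p.eval t := by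
  refine ⟨fun hlt => ?_, fun hpos => ?_⟩
  · simpa [pow_add] using
      h.eval_sign hp (j := j + 1) (by omega) (fun _ => hlt) fun hjn => hu (by omega)
  · by_contra! hle
    rcases hle.eq_or_lt with rfl | hlt
    · rw [h.eval_eq_zero ⟨by omega, by omega⟩] at hpos
      simp at hpos
    · have hneg := h.eval_sign hp (by omega) hl fun _ => hlt
      rw [add_right_comm, pow_succ] at hneg
      linarith

theorem gt_iff_eval_neg (h : AreOrderedZeros p (n + 1) x) (hp : p.Monic) {j : ℕ} (hj : j ≤ n)
    {t : ℝ} (hl : 1 ≤ j → x j < t) (hu : j < n → t < x (j + 2)) :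
    t < x (j + 1) ↔ (-1) ^ (n + j) * p.eval t < 0 := by
  refine ⟨fun hlt => ?_, fun hneg => ?_⟩
  · have hpos := h.eval_sign hp (by omega) hl fun _ => hlt
    rw [add_right_comm, pow_succ] at hpos
    linarith
  · by_contra! hle
    rcases hle.eq_or_lt with rfl | hlt
    · rw [h.eval_eq_zero ⟨by omega, by omega⟩] at hneg
      simp at hneg
    · exact hneg.not_gt ((h.lt_iff_eval_pos hp hj hl hu).1 hlt)

end AreOrderedZeros

theorem exists_eval_eq_zero_mem_Ioo (p : ℝ[X]) (s : ℝ) {a b : ℝ} (hab : a ≤ b)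
    (ha : s * p.eval a < 0) (hb : 0 < s * p.eval b) : ∃ t ∈ Set.Ioo a b, p.eval t = 0 := by
  obtain ⟨t, ht, h0⟩ := intermediate_value_Ioo hab (f := fun t => s * p.eval t)
    (continuous_const.mul p.continuous).continuousOn ⟨ha, hb⟩
  exact ⟨t, ht, (mul_eq_zero.1 h0).resolve_left (left_ne_zero_of_mul hb.ne')⟩

theorem exists_areOrderedZeros_of_nodes (hp : p.Monic) (hn : p.natDegree = n) (e : ℕ → ℝ)
    (he : ∀ j < n, e j ≤ e (j + 1)) (hsign : ∀ j ≤ n, 0 < (-1) ^ (n + j) * p.eval (e j)) :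
    ∃ x, AreOrderedZeros p n x ∧ ∀ j < n, e j < x (j + 1) ∧ x (j + 1) < e (j + 1) := by
  have hzero : ∀ j < n, ∃ t ∈ Set.Ioo (e j) (e (j + 1)), p.eval t = 0 := fun j hj => by
    refine exists_eval_eq_zero_mem_Ioo p ((-1) ^ (n + (j + 1))) (he j hj) ?_ (hsign (j + 1) hj)
    have hpos := hsign j hj.le
    rw [← add_assoc, pow_succ]
    linarith
  choose! z hz hz0 using hzero
  refine ⟨fun j => z (j - 1), .of_monic hp hn ?_ ?_, fun j hj => hz j hj⟩
  · refine strictMonoOn_of_lt_add_one Set.ordConnected_Icc fun j _ hj hj' => ?_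
    obtain ⟨i, rfl⟩ := Nat.exists_eq_add_of_le' hj.1
    exact (hz i (by have := hj.2; omega)).2.trans (hz (i + 1) hj'.2).1
  · exact fun j hj => hz0 _ (by have := hj.1; have := hj.2; omega)

theorem exists_gt_eval_pos (hp : p.Monic) (hd : 0 < p.natDegree) (B : ℝ) :
    ∃ M, B < M ∧ 0 < p.eval M := by
  have h := p.tendsto_atTop_of_leadingCoeff_nonneg (natDegree_pos_iff_degree_pos.1 hd)
    (by rw [hp.leadingCoeff]; exact zero_le_one)
  exact ((Filter.eventually_gt_atTop B).and (h.eventually_gt_atTop 0)).exists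

theorem exists_lt_eval_sign (hp : p.Monic) (hd : 0 < p.natDegree) (B : ℝ) :
    ∃ M, M < B ∧ 0 < (-1) ^ p.natDegree * p.eval M := by
  obtain ⟨M, hBM, hM⟩ := exists_gt_eval_pos (p := C ((-1) ^ p.natDegree) * p.comp (-X))
    (by
      rw [Monic, leadingCoeff_mul, comp_neg_X_leadingCoeff_eq, hp.leadingCoeff, leadingCoeff_C,
        mul_one, ← mul_pow]
      simp)
    (by rwa [natDegree_C_mul (pow_ne_zero _ (by norm_num)), natDegree_comp, natDegree_neg,
      natDegree_X, mul_one]) (-B)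
  exact ⟨-M, by linarith, by simpa using hM⟩

theorem exists_interlacing_zeros_of_sign (hp : p.Monic) (hn : p.natDegree = n + 1)
    (hw : StrictMonoOn w (Set.Icc 1 n))
    (hsign : ∀ j ∈ Set.Icc 1 n, 0 < (-1) ^ (n + 1 + j) * p.eval (w j)) :
    ∃ x, AreOrderedZeros p (n + 1) x ∧ Interlaces n x w := by
  obtain ⟨L, hL, hLs⟩ := exists_lt_eval_sign hp (by omega) (w 1)
  obtain ⟨U, hU, hUs⟩ := exists_gt_eval_pos hp (by omega) (max L (w n))
  obtain ⟨hLU, hwU⟩ := max_lt_iff.1 hU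
  set e : ℕ → ℝ := Function.update (Function.update w 0 L) (n + 1) U with he
  have e_zero : e 0 = L := by simp [he]
  have e_last : e (n + 1) = U := by simp [he]
  have e_mid : ∀ j ∈ Set.Icc 1 n, e j = w j := fun j hj => by
    rw [he, Function.update_of_ne (by have := hj.2; omega),
      Function.update_of_ne (by have := hj.1; omega)]
  have e_le : ∀ j < n + 1, e j ≤ e (j + 1) := fun j hj => by
    rcases j.eq_zero_or_pos with rfl | hj0 <;> rcases (Nat.le_of_lt_succ hj).eq_or_lt with rfl | hjn
    · rw [e_zero, e_last]
      exact hLU.le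
    · rw [e_zero, zero_add, e_mid 1 ⟨le_rfl, hjn⟩]
      exact hL.le
    · rw [e_last, e_mid j ⟨hj0, le_rfl⟩]
      exact hwU.le
    · have hj' : j ∈ Set.Icc 1 n := ⟨hj0, hjn.le⟩
      have hj'' : j + 1 ∈ Set.Icc 1 n := ⟨by omega, hjn⟩
      rw [e_mid j hj', e_mid _ hj'']
      exact (hw hj' hj'' j.lt_succ_self).le
  have e_sign : ∀ j ≤ n + 1, 0 < (-1) ^ (n + 1 + j) * p.eval (e j) := fun j hj => by
    rcases j.eq_zero_or_pos with rfl | hj0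
    · rwa [e_zero, add_zero, ← hn]
    rcases hj.eq_or_lt with rfl | hjn
    · rwa [e_last, Even.neg_one_pow ⟨_, rfl⟩, one_mul]
    · have hj' : j ∈ Set.Icc 1 n := ⟨hj0, Nat.le_of_lt_succ hjn⟩
      rw [e_mid j hj']
      exact hsign j hj'
  obtain ⟨x, hx, hex⟩ := exists_areOrderedZeros_of_nodes hp hn e e_le e_sign
  refine ⟨x, hx, fun j hj => ?_⟩
  obtain ⟨i, rfl⟩ := Nat.exists_eq_add_of_le' hj.1
  have hi := hj.2
  rw [← e_mid _ hj]
  exact ⟨(hex i (by omega)).2, (hex (i + 1) (by omega)).1⟩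

theorem AreOrderedZeros.eval_sign_of_interlaces (hr : AreOrderedZeros r n w) (hrm : r.Monic)
    (hxw : Interlaces n x w) {j : ℕ} (hj : j ≤ n) :
    0 < (-1) ^ (n + j) * r.eval (x (j + 1)) :=
  hr.eval_sign hrm hj (fun h => (hxw j ⟨h, hj⟩).2) fun h => (hxw (j + 1) ⟨by omega, h⟩).1

theorem exists_interlacing_zeros_of_recurrence {p : ℕ → ℝ[X]} {s c : ℕ → ℝ} {a b : ℝ}
    (hp : ∀ n, (p n).Monic) (hd : ∀ n, (p n).natDegree = n) (hc : ∀ n, 0 < c n)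
    (hrec : ∀ n, p (n + 2) = (X - C (s n)) * p (n + 1) - C (c n) * p n)
    (ha : ∀ n, 0 < (-1) ^ n * (p n).eval a) (hb : ∀ n, 0 < (p n).eval b) (n : ℕ) :
    ∃ x w, AreOrderedZeros (p (n + 1)) (n + 1) x ∧ AreOrderedZeros (p n) n w ∧
      Interlaces n x w ∧ a < x 1 ∧ x (n + 1) < b := by
  induction n with
  | zero =>
    obtain ⟨x, hx, hxx⟩ := exists_interlacing_zeros_of_sign (w := 0) (hp 1) (hd 1)
      (fun i hi => absurd (hi.1.trans hi.2) (by norm_num)) (by simp)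
    refine ⟨x, 0, hx, .of_monic (hp 0) (hd 0) ?_ (by simp), hxx, ?_, ?_⟩
    · exact fun i hi => absurd (hi.1.trans hi.2) (by norm_num)
    · have := ha 1
      exact (hx.gt_iff_eval_neg (hp 1) le_rfl (by simp) (by simp)).2 (by simpa using this)
    · exact (hx.lt_iff_eval_pos (hp 1) le_rfl (by simp) (by simp)).2 (by simpa using hb 1)
  | succ n ih =>
    obtain ⟨x, w, hx, hw, hxw, hax, hxb⟩ := ih
    have hsign : ∀ j ∈ Set.Icc 1 (n + 1), 0 < (-1) ^ (n + 1 + 1 + j) * (p (n + 2)).eval (x j) := by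
      intro j hj
      obtain ⟨i, rfl⟩ := Nat.exists_eq_add_of_le' hj.1
      have hpos := mul_pos (hc n)
        (hw.eval_sign_of_interlaces (hp n) hxw (Nat.le_of_succ_le_succ hj.2))
      rw [hrec, eval_sub, eval_mul, hx.eval_eq_zero hj, eval_mul, eval_C,
        show n + 1 + 1 + (i + 1) = n + i + 1 + 2 by ring, pow_add, pow_succ]
      linarith
    obtain ⟨v, hv, hvx⟩ := exists_interlacing_zeros_of_sign (hp _) (hd _) hx.strictMonoOn hsign
    refine ⟨v, x, hv, hx, hvx, ?_, ?_⟩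
    · refine (hv.gt_iff_eval_neg (hp _) (Nat.zero_le _) (by simp) fun _ => ?_).2 ?_
      · exact hax.trans (hvx 1 ⟨le_rfl, by omega⟩).2
      · have hpos := ha (n + 2)
        rw [pow_succ] at hpos
        rw [add_zero]
        linarith
    · refine (hv.lt_iff_eval_pos (hp _) le_rfl (fun _ => ?_) (by simp)).2 ?_
      · exact (hvx (n + 1) ⟨by omega, le_rfl⟩).1.trans hxb
      · rw [Even.neg_one_pow ⟨_, rfl⟩, one_mul]
        exact hb _

theorem monic_add_C_mul (hp : p.Monic) (c : ℝ) (h : r.natDegree < p.natDegree) :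
    (p + C c * r).Monic :=
  hp.add_of_left (degree_lt_degree ((natDegree_C_mul_le _ _).trans_lt h))

theorem natDegree_add_C_mul (c : ℝ) (h : r.natDegree < p.natDegree) :
    (p + C c * r).natDegree = p.natDegree :=
  natDegree_add_eq_left_of_natDegree_lt ((natDegree_C_mul_le _ _).trans_lt h)

section Perturbation

variable {c : ℝ} (hp : AreOrderedZeros p (n + 1) x) (hpm : p.Monic) (hr : AreOrderedZeros r n w)
  (hrm : r.Monic) (hxw : Interlaces n x w)
include hp hpm hr hxw

theorem exists_interlacing_zeros_add_C_mul (c : ℝ) :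
    ∃ y, AreOrderedZeros (p + C c * r) (n + 1) y ∧ Interlaces n y w := by
  refine exists_interlacing_zeros_of_sign (monic_add_C_mul hpm c (hp.natDegree_lt hr))
    ((natDegree_add_C_mul c (hp.natDegree_lt hr)).trans hp.natDegree_eq) hr.strictMonoOn
    fun j hj => ?_
  rw [eval_add, eval_mul, hr.eval_eq_zero hj, mul_zero, add_zero]
  exact hp.eval_sign hpm (hj.2.trans n.le_succ) (fun _ => (hxw j hj).1) fun _ => (hxw j hj).2

include hrm

theorem zeros_add_C_mul_lt_iff (hy : AreOrderedZeros (p + C c * r) (n + 1) y)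
    (hyw : Interlaces n y w) {j : ℕ} (hj : j ∈ Set.Icc 1 (n + 1)) :
    (y j < x j ↔ 0 < c) ∧ (x j < y j ↔ c < 0) := by
  obtain ⟨i, rfl⟩ := Nat.exists_eq_add_of_le' hj.1
  have hin : i ≤ n := Nat.le_of_succ_le_succ hj.2
  have hym := monic_add_C_mul hpm c (hp.natDegree_lt hr)
  have hl : 1 ≤ i → y i < x (i + 1) := fun h => (hyw i ⟨h, hin⟩).1.trans (hxw i ⟨h, hin⟩).2
  have hu : i < n → x (i + 1) < y (i + 2) := fun h =>
    (hxw (i + 1) ⟨by omega, h⟩).1.trans (hyw (i + 1) ⟨by omega, h⟩).2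
  have heval : (-1) ^ (n + i) * (p + C c * r).eval (x (i + 1)) =
      c * ((-1) ^ (n + i) * r.eval (x (i + 1))) := by
    rw [eval_add, eval_mul, eval_C, hp.eval_eq_zero hj, zero_add, mul_left_comm]
  have hpos := hr.eval_sign_of_interlaces hrm hxw hin
  rw [hy.lt_iff_eval_pos hym hin hl hu, hy.gt_iff_eval_neg hym hin hl hu, heval]
  exact ⟨mul_pos_iff_of_pos_right hpos, by
    rw [← neg_pos, ← neg_mul, mul_pos_iff_of_pos_right hpos, neg_pos]⟩

end Perturbation

end Zeros

section QPochhammer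

variable {a q : ℝ}

theorem qPoch_zero (a q : ℝ) : qPoch a q 0 = 1 := Finset.prod_range_zero _

theorem qPoch_succ (a q : ℝ) (m : ℕ) : qPoch a q (m + 1) = qPoch a q m * (1 - a * q ^ m) :=
  Finset.prod_range_succ _ _

theorem qPoch_add (a q : ℝ) (m k : ℕ) :
    qPoch a q (m + k) = qPoch a q m * qPoch (a * q ^ m) q k := by
  simp only [qPoch, Finset.prod_range_add, pow_add, mul_assoc]

theorem qPoch_succ_left (a q : ℝ) (m : ℕ) :
    qPoch a q (m + 1) = (1 - a) * qPoch (a * q) q m := by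
  rw [add_comm, qPoch_add, qPoch_succ, qPoch_zero, pow_zero, mul_one, one_mul, pow_one]

theorem qPoch_ne_zero {m : ℕ} (h : ∀ j < m, a * q ^ j ≠ 1) : qPoch a q m ≠ 0 :=
  Finset.prod_ne_zero_iff.2 fun j hj => sub_ne_zero.2 (h j (Finset.mem_range.1 hj)).symm

theorem qPoch_self_ne_zero (hq : ∀ j, q ^ (j + 1) ≠ 1) (m : ℕ) : qPoch q q m ≠ 0 :=
  qPoch_ne_zero fun j _ => by
    rw [← pow_succ']
    exact hq j

theorem qPoch_pow_mul_qPoch_self (q : ℝ) (m k : ℕ) :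
    qPoch (q ^ (m + 1)) q k * qPoch q q m = qPoch q q (m + k) := by
  rw [qPoch_add, pow_succ', mul_comm]

theorem neg_one_pow_mul_qPoch_inv_pow (hq : q ≠ 0) (m k : ℕ) :
    (-1) ^ (m + k) * q ^ (m + k).choose 2 * qPoch (q ^ (m + k))⁻¹ q m * q ^ m =
      (-1) ^ k * q ^ k.choose 2 * qPoch (q ^ (k + 1)) q m := by
  induction m with
  | zero => simp [qPoch_zero]
  | succ m ih =>
    have hshift : (q ^ (m + k + 1))⁻¹ * q = (q ^ (m + k))⁻¹ := by
      rw [pow_succ, mul_inv, inv_mul_cancel_right₀ hq]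
    have hfactor : -q ^ (m + k) * q * (1 - (q ^ (m + k + 1))⁻¹) = 1 - q ^ (k + 1) * q ^ m := by
      field_simp
      ring
    rw [add_right_comm m 1 k, qPoch_succ_left, hshift, qPoch_succ, ← hfactor,
      Nat.choose_succ_succ', Nat.choose_one_right]
    linear_combination (-q ^ (m + k) * q * (1 - (q ^ (m + k + 1))⁻¹)) * ih

end QPochhammer

section Coefficients

/-- The coefficient of `x ^ m` in the monic little `q`-Jacobi polynomial of degree `m + k`,
in a form in which shifts of `α` and `β` only shift the bases of the `q`-Pochhammer symbols. -/
noncomputable def littleQJacobiCoeff (q α β : ℝ) (m k : ℕ) : ℝ :=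
  (-1) ^ k * q ^ k.choose 2 * (qPoch (q ^ (m + 1)) q k / qPoch q q k) *
    (qPoch (α * q ^ (m + 1)) q k / qPoch (α * β * q ^ (2 * m + k + 1)) q k)

variable {q α β : ℝ}

theorem littleQJacobiCoeff_zero (q α β : ℝ) (m : ℕ) : littleQJacobiCoeff q α β m 0 = 1 := by
  simp [littleQJacobiCoeff, qPoch_zero]

theorem natDegree_littleQJacobi_le (q α β : ℝ) (n : ℕ) : (littleQJacobi q α β n).natDegree ≤ n :=
  (natDegree_C_mul_le _ _).trans <| natDegree_sum_le_of_forall_le _ _ fun m hm =>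
    (natDegree_C_mul_X_pow_le _ m).trans (Finset.mem_range_succ_iff.1 hm)

theorem coeff_littleQJacobi_of_le (q α β : ℝ) {m n : ℕ} (h : m ≤ n) :
    (littleQJacobi q α β n).coeff m =
      (-1) ^ n * q ^ n.choose 2 * qPoch (α * q) q n / qPoch (α * β * q * q ^ n) q n *
        (qPoch (q ^ n)⁻¹ q m * qPoch (α * β * q ^ (n + 1)) q m / qPoch (α * q) q m *
          (q ^ m / qPoch q q m)) := by
  rw [littleQJacobi, coeff_C_mul, finsetSum_coeff, Finset.sum_eq_single_of_mem m
    (Finset.mem_range_succ_iff.2 h) fun b _ hb => by rw [coeff_C_mul_X_pow, if_neg hb.symm],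
    coeff_C_mul_X_pow, if_pos rfl]

theorem qPoch_mul_pow_ne_zero {t : ℝ} {i k : ℕ} (ht : ∀ j, i ≤ j → j < i + k → t * q ^ j ≠ 1) :
    qPoch (t * q ^ i) q k ≠ 0 :=
  qPoch_ne_zero fun j hj => by
    rw [mul_assoc, ← pow_add]
    exact ht _ (i.le_add_right j) (Nat.add_lt_add_left hj i)

variable (hq0 : q ≠ 0) (hq : ∀ j, q ^ (j + 1) ≠ 1) (hα : ∀ j, α * q ^ (j + 1) ≠ 1)
include hq0 hq hα

theorem coeff_littleQJacobi {m k n : ℕ} (hn : m + k = n)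
    (ht : ∀ j ∈ Set.Ioc n (2 * n), α * β * q ^ j ≠ 1) :
    (littleQJacobi q α β n).coeff m = littleQJacobiCoeff q α β m k := by
  subst hn
  have hm := qPoch_self_ne_zero hq m
  have hk := qPoch_self_ne_zero hq k
  have hαm : qPoch (α * q) q m ≠ 0 := qPoch_ne_zero fun j _ => by
    rw [mul_assoc, ← pow_succ']
    exact hα j
  have hm' : qPoch (α * β * q ^ (m + k + 1)) q m ≠ 0 :=
    qPoch_mul_pow_ne_zero fun j hj hj' => ht j ⟨by omega, by omega⟩
  have hk' : qPoch (α * β * q ^ (2 * m + k + 1)) q k ≠ 0 :=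
    qPoch_mul_pow_ne_zero fun j hj hj' => ht j ⟨by omega, by omega⟩
  have hnum : qPoch (α * q) q (m + k) = qPoch (α * q) q m * qPoch (α * q ^ (m + 1)) q k := by
    rw [qPoch_add, mul_assoc, ← pow_succ']
  have hden : qPoch (α * β * q * q ^ (m + k)) q (m + k) =
      qPoch (α * β * q ^ (m + k + 1)) q m * qPoch (α * β * q ^ (2 * m + k + 1)) q k := by
    rw [mul_assoc _ q, ← pow_succ', qPoch_add, mul_assoc _ (q ^ _), ← pow_add,
      show m + k + 1 + m = 2 * m + k + 1 by ring]
  have hswap : qPoch (q ^ (k + 1)) q m * qPoch q q k = qPoch (q ^ (m + 1)) q k * qPoch q q m := by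
    rw [qPoch_pow_mul_qPoch_self, qPoch_pow_mul_qPoch_self, add_comm]
  have hrev := neg_one_pow_mul_qPoch_inv_pow hq0 m k
  rw [coeff_littleQJacobi_of_le q α β (m.le_add_right k), hnum, hden, littleQJacobiCoeff]
  generalize qPoch (q ^ (m + k))⁻¹ q m = V at hrev ⊢
  field_simp
  linear_combination qPoch (α * q ^ (m + 1)) q k *
    (qPoch q q k * hrev + (-1) ^ k * q ^ k.choose 2 * hswap)

theorem coeff_littleQJacobi_self {n : ℕ}
    (ht : ∀ j ∈ Set.Ioc n (2 * n), α * β * q ^ j ≠ 1) : (littleQJacobi q α β n).coeff n = 1 :=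
  (coeff_littleQJacobi hq0 hq hα n.add_zero ht).trans (littleQJacobiCoeff_zero q α β n)

theorem monic_littleQJacobi {n : ℕ}
    (ht : ∀ j ∈ Set.Ioc n (2 * n), α * β * q ^ j ≠ 1) : (littleQJacobi q α β n).Monic :=
  monic_of_natDegree_le_of_coeff_eq_one n (natDegree_littleQJacobi_le q α β n)
    (coeff_littleQJacobi_self hq0 hq hα ht)

theorem natDegree_littleQJacobi {n : ℕ}
    (ht : ∀ j ∈ Set.Ioc n (2 * n), α * β * q ^ j ≠ 1) : (littleQJacobi q α β n).natDegree = n :=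
  natDegree_eq_of_le_of_coeff_ne_zero (natDegree_littleQJacobi_le q α β n)
    ((coeff_littleQJacobi_self hq0 hq hα ht).trans_ne one_ne_zero)

end Coefficients

theorem littleQJacobi_zero (q α β : ℝ) : littleQJacobi q α β 0 = 1 := by
  simp [littleQJacobi, qPoch_zero]

section Relations

/-- The quotient `(1 - t q ^ (n + 1)) / (1 - t q ^ (2 * n + 1))`, continued by `1` to `n = 0`, where
it could be `0 / 0`. -/
noncomputable def tailRatio (q t : ℝ) (n : ℕ) : ℝ :=
  if n = 0 then 1 else (1 - t * q ^ (n + 1)) / (1 - t * q ^ (2 * n + 1))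

/-- The quotient `-p (n + 1) / p n` of values at `0`, where `p` is the family of monic little
`q`-Jacobi polynomials. -/
noncomputable def valueRatioZero (q α β : ℝ) (n : ℕ) : ℝ :=
  q ^ n * (1 - α * q ^ (n + 1)) * tailRatio q (α * β) n / (1 - α * β * q ^ (2 * n + 2))

/-- The quotient `p (n + 1) / p n` of values at `1`, where `p` is the family of monic little
`q`-Jacobi polynomials. -/
noncomputable def valueRatioOne (q α β : ℝ) (n : ℕ) : ℝ :=
  α * q ^ (2 * n + 1) * (1 - β * q ^ (n + 1)) * tailRatio q (α * β) n /
    (1 - α * β * q ^ (2 * n + 2))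

/-- The coefficient of degree `n` when the monic little `q`-Jacobi polynomial of degree `n + 1` with
parameters `α`, `β` is expanded in those with parameters `α * q`, `β`. -/
noncomputable def alphaConnectionCoeff (q α β : ℝ) (n : ℕ) : ℝ :=
  α * q ^ (n + 1) * (1 - q ^ (n + 1)) * (1 - β * q ^ (n + 1)) /
    ((1 - α * β * q ^ (2 * n + 2)) * (1 - α * β * q ^ (2 * n + 3)))

/-- Minus the coefficient of degree `n` when the monic little `q`-Jacobi polynomial of degree
`n + 1` with parameters `α`, `β` is expanded in those with parameters `α`, `β * q`. -/
noncomputable def betaConnectionCoeff (q α β : ℝ) (n : ℕ) : ℝ :=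
  α * β * q ^ (2 * n + 2) * (1 - q ^ (n + 1)) * (1 - α * q ^ (n + 1)) /
    ((1 - α * β * q ^ (2 * n + 2)) * (1 - α * β * q ^ (2 * n + 3)))

variable {q α β : ℝ}

theorem qPoch_mul_pow_succ (t q : ℝ) (i k : ℕ) :
    qPoch (t * q ^ i) q (k + 1) = qPoch (t * q ^ i) q k * (1 - t * q ^ (i + k)) := by
  rw [qPoch_succ, mul_assoc, ← pow_add]

theorem qPoch_mul_pow_succ_left (t q : ℝ) (i k : ℕ) :
    qPoch (t * q ^ i) q (k + 1) = (1 - t * q ^ i) * qPoch (t * q ^ (i + 1)) q k := by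
  rw [qPoch_succ_left, mul_assoc, ← pow_succ]

theorem qPoch_mul_pow_succ_succ {t : ℝ} {i : ℕ} (h : t * q ^ i ≠ 1) (k : ℕ) :
    qPoch (t * q ^ (i + 1)) q (k + 1) =
      qPoch (t * q ^ i) q k * (1 - t * q ^ (i + k)) * (1 - t * q ^ (i + k + 1)) /
        (1 - t * q ^ i) := by
  rw [eq_div_iff (sub_ne_zero.2 h.symm), mul_comm, ← qPoch_mul_pow_succ_left, qPoch_mul_pow_succ,
    qPoch_mul_pow_succ, add_assoc]

theorem littleQJacobiCoeff_succ (q α β : ℝ) (m k : ℕ) :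
    littleQJacobiCoeff q α β m (k + 1) = -((-1) ^ k * q ^ k.choose 2 * q ^ k *
      (qPoch (q ^ (m + 1)) q (k + 1) / (qPoch q q k * (1 - q ^ (k + 1)))) *
        (qPoch (α * q ^ (m + 1)) q (k + 1) / qPoch (α * β * q ^ (2 * m + k + 2)) q (k + 1))) := by
  rw [littleQJacobiCoeff, Nat.choose_succ_succ', Nat.choose_one_right, qPoch_succ q q,
    ← pow_succ', show 2 * m + (k + 1) + 1 = 2 * m + k + 2 by ring]
  ring

theorem littleQJacobiCoeff_mul_alpha (q α β : ℝ) (m k : ℕ) :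
    littleQJacobiCoeff q (α * q) β m k =
      (-1) ^ k * q ^ k.choose 2 * (qPoch (q ^ (m + 1)) q k / qPoch q q k) *
        (qPoch (α * q ^ (m + 2)) q k / qPoch (α * β * q ^ (2 * m + k + 2)) q k) := by
  rw [littleQJacobiCoeff, mul_right_comm α q β, mul_assoc α q, mul_assoc _ q, ← pow_succ',
    ← pow_succ']

theorem littleQJacobiCoeff_mul_beta (q α β : ℝ) (m k : ℕ) :
    littleQJacobiCoeff q α (β * q) m k =
      (-1) ^ k * q ^ k.choose 2 * (qPoch (q ^ (m + 1)) q k / qPoch q q k) *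
        (qPoch (α * q ^ (m + 1)) q k / qPoch (α * β * q ^ (2 * m + k + 2)) q k) := by
  rw [littleQJacobiCoeff, ← mul_assoc α, mul_assoc _ q, ← pow_succ']

section Connection

variable (hq : ∀ j, q ^ (j + 1) ≠ 1) {m k : ℕ} (ht : ∀ j, m + k + 2 ≤ j → α * β * q ^ j ≠ 1)
include hq ht

theorem littleQJacobiCoeff_eq_add_alphaConnectionCoeff_mul :
    littleQJacobiCoeff q α β m (k + 1) =
      littleQJacobiCoeff q (α * q) β m (k + 1) +
        alphaConnectionCoeff q α β (m + k) * littleQJacobiCoeff q (α * q) β m k := by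
  have hden : ∀ j, m + k + 2 ≤ j → 1 - α * β * q ^ j ≠ 0 := fun j hj => sub_ne_zero.2 (ht j hj).symm
  have hD : qPoch (α * β * q ^ (2 * m + k + 2)) q k ≠ 0 :=
    qPoch_mul_pow_ne_zero fun j hj _ => ht j (by omega)
  have h2 := hden (2 * m + k + 2 + k) (by omega)
  have h3 := hden (2 * m + k + 2 + k + 1) (by omega)
  have hk := qPoch_self_ne_zero hq k
  have hk' := sub_ne_zero.2 (hq k).symm
  rw [littleQJacobiCoeff_succ, littleQJacobiCoeff_mul_alpha, littleQJacobiCoeff_mul_alpha,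
    Nat.choose_succ_succ', Nat.choose_one_right, qPoch_succ (q ^ (m + 1)), qPoch_succ q q,
    ← pow_succ' q k, qPoch_mul_pow_succ_left α, qPoch_mul_pow_succ α, qPoch_mul_pow_succ (α * β),
    show 2 * m + (k + 1) + 2 = 2 * m + k + 2 + 1 by ring,
    qPoch_mul_pow_succ_succ (ht (2 * m + k + 2) (by omega)), alphaConnectionCoeff,
    show 2 * (m + k) + 2 = 2 * m + k + 2 + k by ring,
    show 2 * (m + k) + 3 = 2 * m + k + 2 + k + 1 by ring]
  generalize qPoch (α * β * q ^ (2 * m + k + 2)) q k = D at hD ⊢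
  generalize qPoch (α * q ^ (m + 1 + 1)) q k = F
  field_simp
  ring

theorem littleQJacobiCoeff_eq_sub_betaConnectionCoeff_mul :
    littleQJacobiCoeff q α β m (k + 1) =
      littleQJacobiCoeff q α (β * q) m (k + 1) -
        betaConnectionCoeff q α β (m + k) * littleQJacobiCoeff q α (β * q) m k := by
  have hden : ∀ j, m + k + 2 ≤ j → 1 - α * β * q ^ j ≠ 0 := fun j hj => sub_ne_zero.2 (ht j hj).symm
  have hD : qPoch (α * β * q ^ (2 * m + k + 2)) q k ≠ 0 :=
    qPoch_mul_pow_ne_zero fun j hj _ => ht j (by omega)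
  have h2 := hden (2 * m + k + 2 + k) (by omega)
  have h3 := hden (2 * m + k + 2 + k + 1) (by omega)
  have hk := qPoch_self_ne_zero hq k
  have hk' := sub_ne_zero.2 (hq k).symm
  rw [littleQJacobiCoeff_succ, littleQJacobiCoeff_mul_beta, littleQJacobiCoeff_mul_beta,
    Nat.choose_succ_succ', Nat.choose_one_right, qPoch_succ (q ^ (m + 1)), qPoch_succ q q,
    ← pow_succ' q k, qPoch_mul_pow_succ α, qPoch_mul_pow_succ (α * β),
    show 2 * m + (k + 1) + 2 = 2 * m + k + 2 + 1 by ring,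
    qPoch_mul_pow_succ_succ (ht (2 * m + k + 2) (by omega)), betaConnectionCoeff,
    show 2 * (m + k) + 2 = 2 * m + k + 2 + k by ring,
    show 2 * (m + k) + 3 = 2 * m + k + 2 + k + 1 by ring]
  generalize qPoch (α * β * q ^ (2 * m + k + 2)) q k = D at hD ⊢
  generalize qPoch (α * q ^ (m + 1)) q k = F
  field_simp
  ring

end Connection

theorem tailRatio_mul {t : ℝ} {n : ℕ} (h : 1 ≤ n → t * q ^ (2 * n + 1) ≠ 1) :
    tailRatio q t n * (1 - t * q ^ (2 * n + 1)) = 1 - t * q ^ (n + 1) := by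
  rw [tailRatio]
  split_ifs with hn
  · rw [hn, one_mul]
  · exact div_mul_cancel₀ _ (sub_ne_zero.2 (h (Nat.one_le_iff_ne_zero.2 hn)).symm)

theorem tailRatio_succ (q t : ℝ) (n : ℕ) :
    tailRatio q t (n + 1) = (1 - t * q ^ (n + 2)) / (1 - t * q ^ (2 * n + 3)) :=
  if_neg n.succ_ne_zero

theorem qPoch_mul_tailRatio {t : ℝ} {n : ℕ} (ht : ∀ j, 2 ≤ j → t * q ^ j ≠ 1) :
    qPoch (t * q ^ (n + 2)) q (n + 1) * tailRatio q t n =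
      qPoch (t * q ^ (n + 1)) q n * (1 - t * q ^ (2 * n + 2)) := by
  rcases n with _ | n
  · simp [qPoch_zero, qPoch_succ, tailRatio]
  · have h1 := sub_ne_zero.2 (ht (n + 2) (by omega)).symm
    have h2 := sub_ne_zero.2 (ht (2 * n + 3) (by omega)).symm
    rw [qPoch_mul_pow_succ_succ (ht (n + 2) (by omega)), tailRatio_succ,
      show n + 1 + 1 + (n + 1) = 2 * n + 3 by ring, show 2 * (n + 1) + 2 = 2 * n + 3 + 1 by ring]
    field_simp

section ValueRatio

variable (hq : ∀ j, q ^ (j + 1) ≠ 1) (ht : ∀ j, 2 ≤ j → α * β * q ^ j ≠ 1)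
include hq ht

theorem littleQJacobiCoeff_mul_alpha_eq_add_valueRatioZero_mul (m k : ℕ) :
    littleQJacobiCoeff q (α * q) β m (k + 1) =
      littleQJacobiCoeff q α β (m + 1) (k + 1) +
        valueRatioZero q α β (m + k + 1) * littleQJacobiCoeff q α β (m + 1) k := by
  have hden : ∀ j, 2 ≤ j → 1 - α * β * q ^ j ≠ 0 := fun j hj => sub_ne_zero.2 (ht j hj).symm
  have hD : qPoch (α * β * q ^ (2 * m + k + 3)) q k ≠ 0 :=
    qPoch_mul_pow_ne_zero fun j hj _ => ht j (by omega)
  have h2 := hden (2 * m + k + 3 + k) (by omega)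
  have h3 := hden (2 * m + k + 3 + k + 1) (by omega)
  have hk := qPoch_self_ne_zero hq k
  have hk' := sub_ne_zero.2 (hq k).symm
  rw [littleQJacobiCoeff_mul_alpha, littleQJacobiCoeff_succ, Nat.choose_succ_succ',
    Nat.choose_one_right, littleQJacobiCoeff, qPoch_succ_left (q ^ (m + 1)), ← pow_succ,
    qPoch_succ (q ^ (m + 1 + 1)), qPoch_succ q q, ← pow_succ' q k, qPoch_mul_pow_succ α,
    show 2 * m + (k + 1) + 2 = 2 * m + k + 3 by ring,
    show 2 * (m + 1) + k + 2 = 2 * m + k + 3 + 1 by ring,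
    show 2 * (m + 1) + k + 1 = 2 * m + k + 3 by ring,
    qPoch_mul_pow_succ_succ (ht (2 * m + k + 3) (by omega)), qPoch_mul_pow_succ (α * β),
    valueRatioZero, tailRatio_succ,
    show 2 * (m + k) + 3 = 2 * m + k + 3 + k by ring,
    show 2 * (m + k + 1) + 2 = 2 * m + k + 3 + k + 1 by ring]
  generalize qPoch (α * β * q ^ (2 * m + k + 3)) q k = D at hD ⊢
  generalize qPoch (α * q ^ (m + 2)) q k = F
  field_simp
  ring

theorem littleQJacobiCoeff_zero_succ (n : ℕ) :
    littleQJacobiCoeff q α β 0 (n + 1) =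
      -(valueRatioZero q α β n * littleQJacobiCoeff q α β 0 n) := by
  have hD : qPoch (α * β * q ^ (n + 1)) q n ≠ 0 :=
    qPoch_mul_pow_ne_zero fun j hj hj' => ht j (by omega)
  have hD' : qPoch (α * β * q ^ (n + 2)) q (n + 1) ≠ 0 :=
    qPoch_mul_pow_ne_zero fun j hj _ => ht j (by omega)
  have hden := sub_ne_zero.2 (ht (2 * n + 2) (by omega)).symm
  have hn := qPoch_self_ne_zero hq n
  have hn' := sub_ne_zero.2 (hq n).symm
  have htail := qPoch_mul_tailRatio (n := n) ht
  rw [littleQJacobiCoeff_succ, littleQJacobiCoeff, valueRatioZero, zero_add, pow_one,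
    qPoch_succ q q, ← pow_succ', mul_zero, zero_add, qPoch_succ, mul_assoc α q, ← pow_succ']
  generalize qPoch (α * β * q ^ (n + 1)) q n = D at hD htail ⊢
  generalize qPoch (α * β * q ^ (n + 2)) q (n + 1) = D' at hD' htail ⊢
  field_simp
  linear_combination
    q ^ n * q ^ n.choose 2 * qPoch (α * q) q n * (1 - α * q ^ (n + 1)) * htail

end ValueRatio

theorem eq_of_monic_of_coeff_eq {p r : ℝ[X]} {n : ℕ} (hp : p.Monic) (hr : r.Monic)
    (hpn : p.natDegree = n) (hrn : r.natDegree = n) (h : ∀ m < n, p.coeff m = r.coeff m) :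
    p = r := by
  ext m
  rcases lt_trichotomy m n with hm | rfl | hm
  · exact h m hm
  · rw [← hpn, hp.coeff_natDegree, hpn, ← hrn, hr.coeff_natDegree]
  · rw [coeff_eq_zero_of_natDegree_lt (hpn ▸ hm), coeff_eq_zero_of_natDegree_lt (hrn ▸ hm)]

theorem eq_add_C_mul_of_coeff_eq {f g h : ℝ[X]} {n : ℕ} {c : ℝ} (hf : f.Monic) (hg : g.Monic)
    (hfn : f.natDegree = n + 1) (hgn : g.natDegree = n + 1) (hhn : h.natDegree ≤ n)
    (hcoeff : ∀ m ≤ n, f.coeff m = g.coeff m + c * h.coeff m) : f = g + C c * h := by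
  have hlt : h.natDegree < g.natDegree := by omega
  refine eq_of_monic_of_coeff_eq hf (monic_add_C_mul hg c hlt) hfn
    ((natDegree_add_C_mul c hlt).trans hgn) fun m hm => ?_
  rw [hcoeff m (Nat.le_of_lt_succ hm), coeff_add, coeff_C_mul]

section Contiguous

variable (hq0 : q ≠ 0) (hq : ∀ j, q ^ (j + 1) ≠ 1) (hα : ∀ j, α * q ^ (j + 1) ≠ 1)
include hq0 hq hα

theorem littleQJacobi_eq_add_alphaConnectionCoeff_mul {n : ℕ}
    (ht : ∀ j, n + 2 ≤ j → α * β * q ^ j ≠ 1) :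
    littleQJacobi q α β (n + 1) = littleQJacobi q (α * q) β (n + 1) +
      C (alphaConnectionCoeff q α β n) * littleQJacobi q (α * q) β n := by
  have hα' : ∀ j, α * q * q ^ (j + 1) ≠ 1 := fun j => by
    rw [mul_assoc, ← pow_succ']
    exact hα (j + 1)
  have ht' : ∀ j, n + 1 ≤ j → α * q * β * q ^ j ≠ 1 := fun j hj => by
    rw [mul_right_comm α, mul_assoc, ← pow_succ']
    exact ht (j + 1) (Nat.succ_le_succ hj)
  have ht₁ : ∀ j ∈ Set.Ioc (n + 1) (2 * (n + 1)), α * β * q ^ j ≠ 1 := fun j hj => ht j hj.1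
  have ht₂ : ∀ j ∈ Set.Ioc (n + 1) (2 * (n + 1)), α * q * β * q ^ j ≠ 1 := fun j hj =>
    ht' j hj.1.le
  refine eq_add_C_mul_of_coeff_eq (monic_littleQJacobi hq0 hq hα ht₁)
    (monic_littleQJacobi hq0 hq hα' ht₂) (natDegree_littleQJacobi hq0 hq hα ht₁)
    (natDegree_littleQJacobi hq0 hq hα' ht₂) (natDegree_littleQJacobi_le _ _ _ _) fun m hm => ?_
  obtain ⟨k, rfl⟩ := Nat.exists_eq_add_of_le hm
  rw [coeff_littleQJacobi hq0 hq hα (m.add_assoc k 1).symm ht₁,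
    coeff_littleQJacobi hq0 hq hα' (m.add_assoc k 1).symm ht₂,
    coeff_littleQJacobi hq0 hq hα' rfl fun j hj => ht' j hj.1]
  exact littleQJacobiCoeff_eq_add_alphaConnectionCoeff_mul hq ht

theorem littleQJacobi_eq_add_neg_betaConnectionCoeff_mul {n : ℕ}
    (ht : ∀ j, n + 2 ≤ j → α * β * q ^ j ≠ 1) :
    littleQJacobi q α β (n + 1) = littleQJacobi q α (β * q) (n + 1) +
      C (-betaConnectionCoeff q α β n) * littleQJacobi q α (β * q) n := by
  have ht' : ∀ j, n + 1 ≤ j → α * (β * q) * q ^ j ≠ 1 := fun j hj => by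
    rw [← mul_assoc α, mul_assoc, ← pow_succ']
    exact ht (j + 1) (Nat.succ_le_succ hj)
  have ht₁ : ∀ j ∈ Set.Ioc (n + 1) (2 * (n + 1)), α * β * q ^ j ≠ 1 := fun j hj => ht j hj.1
  have ht₂ : ∀ j ∈ Set.Ioc (n + 1) (2 * (n + 1)), α * (β * q) * q ^ j ≠ 1 := fun j hj =>
    ht' j hj.1.le
  refine eq_add_C_mul_of_coeff_eq (monic_littleQJacobi hq0 hq hα ht₁)
    (monic_littleQJacobi hq0 hq hα ht₂) (natDegree_littleQJacobi hq0 hq hα ht₁)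
    (natDegree_littleQJacobi hq0 hq hα ht₂) (natDegree_littleQJacobi_le _ _ _ _) fun m hm => ?_
  obtain ⟨k, rfl⟩ := Nat.exists_eq_add_of_le hm
  rw [coeff_littleQJacobi hq0 hq hα (m.add_assoc k 1).symm ht₁,
    coeff_littleQJacobi hq0 hq hα (m.add_assoc k 1).symm ht₂,
    coeff_littleQJacobi hq0 hq hα rfl fun j hj => ht' j hj.1, neg_mul, ← sub_eq_add_neg]
  exact littleQJacobiCoeff_eq_sub_betaConnectionCoeff_mul hq ht

variable (ht : ∀ j, 2 ≤ j → α * β * q ^ j ≠ 1)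
include ht

theorem X_mul_littleQJacobi_mul_alpha (n : ℕ) :
    X * littleQJacobi q (α * q) β n =
      littleQJacobi q α β (n + 1) + C (valueRatioZero q α β n) * littleQJacobi q α β n := by
  have hα' : ∀ j, α * q * q ^ (j + 1) ≠ 1 := fun j => by
    rw [mul_assoc, ← pow_succ']
    exact hα (j + 1)
  have ht' : ∀ j ∈ Set.Ioc n (2 * n), α * q * β * q ^ j ≠ 1 := fun j hj => by
    rw [mul_right_comm α, mul_assoc, ← pow_succ']
    exact ht (j + 1) (by have := hj.1; omega)
  have ht₁ : ∀ j ∈ Set.Ioc (n + 1) (2 * (n + 1)), α * β * q ^ j ≠ 1 := fun j hj =>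
    ht j (by have := hj.1; omega)
  have ht₀ : ∀ j ∈ Set.Ioc n (2 * n), α * β * q ^ j ≠ 1 := fun j hj =>
    ht j (by have := hj.1; have := hj.2; omega)
  have hmonic := monic_littleQJacobi hq0 hq hα' ht'
  refine eq_add_C_mul_of_coeff_eq (monic_X.mul hmonic) (monic_littleQJacobi hq0 hq hα ht₁)
    (by rw [natDegree_X_mul hmonic.ne_zero, natDegree_littleQJacobi hq0 hq hα' ht'])
    (natDegree_littleQJacobi hq0 hq hα ht₁) (natDegree_littleQJacobi_le _ _ _ _) fun m hm => ?_
  rcases m with _ | m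
  · rw [mul_coeff_zero, coeff_X_zero, zero_mul,
      coeff_littleQJacobi hq0 hq hα (zero_add (n + 1)) ht₁,
      coeff_littleQJacobi hq0 hq hα (zero_add n) ht₀, littleQJacobiCoeff_zero_succ hq ht,
      neg_add_cancel]
  · obtain ⟨k, rfl⟩ := Nat.exists_eq_add_of_lt hm
    rw [coeff_X_mul, coeff_littleQJacobi hq0 hq hα' (m.add_assoc k 1).symm ht',
      coeff_littleQJacobi hq0 hq hα (k := k + 1) (by ring) ht₁,
      coeff_littleQJacobi hq0 hq hα (k := k) (by ring) ht₀]
    exact littleQJacobiCoeff_mul_alpha_eq_add_valueRatioZero_mul hq ht m k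

end Contiguous

section ThreeTerm

variable (ht : ∀ j, 2 ≤ j → α * β * q ^ j ≠ 1)
include ht

theorem valueRatioZero_add_valueRatioOne (n : ℕ) :
    valueRatioZero q α β n + valueRatioOne q α β n = tailRatio q (α * β) n * q ^ n := by
  have hden := sub_ne_zero.2 (ht (2 * n + 2) (by omega)).symm
  rw [valueRatioZero, valueRatioOne]
  field_simp
  ring

theorem alphaConnectionCoeff_mul_tailRatio (n : ℕ) :
    alphaConnectionCoeff q α β n * (tailRatio q (α * β) n * q ^ n) =
      (1 - tailRatio q (α * β) (n + 1) * q ^ (n + 1)) * valueRatioOne q α β n := by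
  have h2 := sub_ne_zero.2 (ht (2 * n + 2) (by omega)).symm
  have h3 := sub_ne_zero.2 (ht (2 * n + 3) (by omega)).symm
  rw [alphaConnectionCoeff, valueRatioOne, tailRatio_succ]
  field_simp
  ring

variable (hq0 : q ≠ 0) (hq : ∀ j, q ^ (j + 1) ≠ 1) (hα : ∀ j, α * q ^ (j + 1) ≠ 1)
include hq0 hq hα

theorem eval_zero_littleQJacobi_succ (n : ℕ) :
    (littleQJacobi q α β (n + 1)).eval 0 =
      -(valueRatioZero q α β n * (littleQJacobi q α β n).eval 0) := by
  have h := congrArg (eval 0) (X_mul_littleQJacobi_mul_alpha hq0 hq hα ht n)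
  rw [eval_mul, eval_X, zero_mul, eval_add, eval_mul, eval_C] at h
  linarith

theorem littleQJacobi_add_two (n : ℕ) :
    littleQJacobi q α β (n + 2) =
      (X - C (valueRatioZero q α β (n + 1) + alphaConnectionCoeff q α β n)) *
          littleQJacobi q α β (n + 1) -
        C (valueRatioZero q α β n * alphaConnectionCoeff q α β n) * littleQJacobi q α β n := by
  have hconnection := littleQJacobi_eq_add_alphaConnectionCoeff_mul hq0 hq hα (n := n)
    fun j hj => ht j (by omega)
  have hX := X_mul_littleQJacobi_mul_alpha hq0 hq hα ht
  rw [C_add, C_mul]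
  linear_combination -X * hconnection - hX (n + 1) - C (alphaConnectionCoeff q α β n) * hX n

theorem eval_one_littleQJacobi_succ (n : ℕ) :
    (littleQJacobi q α β (n + 1)).eval 1 =
      valueRatioOne q α β n * (littleQJacobi q α β n).eval 1 := by
  induction n with
  | zero =>
    have hX := congrArg (eval 1) (X_mul_littleQJacobi_mul_alpha hq0 hq hα ht 0)
    have hsum := valueRatioZero_add_valueRatioOne ht 0
    rw [littleQJacobi_zero, littleQJacobi_zero, mul_one, mul_one, eval_X, eval_add, eval_C] at hX
    rw [tailRatio, if_pos rfl, pow_zero, mul_one] at hsum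
    rw [littleQJacobi_zero, eval_one]
    linarith
  | succ n ih =>
    have hrec := congrArg (eval 1) (littleQJacobi_add_two ht hq0 hq hα n)
    simp only [eval_sub, eval_mul, eval_X, eval_C, ih] at hrec
    rw [hrec, ih]
    linear_combination (-(littleQJacobi q α β n).eval 1) *
      (alphaConnectionCoeff_mul_tailRatio ht n +
        alphaConnectionCoeff q α β n * valueRatioZero_add_valueRatioOne ht n +
        valueRatioOne q α β n * valueRatioZero_add_valueRatioOne ht (n + 1))

end ThreeTerm

section Shift

variable {n : ℕ} (ht : ∀ j, n + 2 ≤ j → α * β * q ^ j ≠ 1)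
include ht

theorem alphaConnectionCoeff_sub_valueRatioZero :
    alphaConnectionCoeff q α β n - valueRatioZero q (α * q) β n =
      q ^ n * (α * q - 1) / (1 - α * β * q ^ (2 * n + 2)) := by
  have h2 := sub_ne_zero.2 (ht (2 * n + 2) (by omega)).symm
  have h3 := sub_ne_zero.2 (ht (2 * n + 3) (by omega)).symm
  have hpow : ∀ j, α * q * β * q ^ j = α * β * q ^ (j + 1) := fun j => by ring
  have htail : tailRatio q (α * q * β) n * (1 - α * β * q ^ (2 * n + 2)) =
      1 - α * β * q ^ (n + 2) := by
    rw [← hpow, ← hpow]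
    exact tailRatio_mul fun _ => by
      rw [hpow]
      exact ht _ (by omega)
  rw [← eq_div_iff h2] at htail
  rw [alphaConnectionCoeff, valueRatioZero, htail, hpow]
  field_simp
  ring

theorem valueRatioOne_sub_betaConnectionCoeff :
    valueRatioOne q α (β * q) n - betaConnectionCoeff q α β n =
      α * q ^ (2 * n + 1) * (1 - β * q) / (1 - α * β * q ^ (2 * n + 2)) := by
  have h2 := sub_ne_zero.2 (ht (2 * n + 2) (by omega)).symm
  have h3 := sub_ne_zero.2 (ht (2 * n + 3) (by omega)).symm
  have hpow : ∀ j, α * (β * q) * q ^ j = α * β * q ^ (j + 1) := fun j => by ring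
  have htail : tailRatio q (α * (β * q)) n * (1 - α * β * q ^ (2 * n + 2)) =
      1 - α * β * q ^ (n + 2) := by
    rw [← hpow, ← hpow]
    exact tailRatio_mul fun _ => by
      rw [hpow]
      exact ht _ (by omega)
  rw [← eq_div_iff h2] at htail
  rw [betaConnectionCoeff, valueRatioOne, htail, hpow]
  field_simp
  ring

end Shift

end Relations

section Positivity

variable {q α β : ℝ}

theorem mul_pow_lt_one {a : ℝ} (hq0 : 0 < q) (hq1 : q ≤ 1) (ha : a < 1) (k : ℕ) :
    a * q ^ k < 1 := by
  rcases le_or_gt a 0 with h | h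
  · exact (mul_nonpos_of_nonpos_of_nonneg h (pow_nonneg hq0.le k)).trans_lt one_pos
  · exact (mul_le_of_le_one_right h.le (pow_le_one₀ hq0.le hq1)).trans_lt ha

theorem mul_pow_succ_lt_one (hq0 : 0 < q) (hq1 : q ≤ 1) {a : ℝ} (ha : a * q < 1) (k : ℕ) :
    a * q ^ (k + 1) < 1 := by
  rw [pow_succ', ← mul_assoc]
  exact mul_pow_lt_one hq0 hq1 ha k

theorem tailRatio_pos {t : ℝ} (ht : ∀ j, 2 ≤ j → t * q ^ j < 1) (n : ℕ) : 0 < tailRatio q t n := by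
  rcases n with _ | n
  · simp [tailRatio]
  · rw [tailRatio_succ]
    exact div_pos (sub_pos.2 (ht _ (by omega))) (sub_pos.2 (ht _ (by omega)))

theorem valueRatioZero_pos (hq0 : 0 < q) {n : ℕ} (hα : α * q ^ (n + 1) < 1)
    (ht : ∀ j, 2 ≤ j → α * β * q ^ j < 1) : 0 < valueRatioZero q α β n :=
  div_pos (mul_pos (mul_pos (pow_pos hq0 n) (sub_pos.2 hα)) (tailRatio_pos ht n))
    (sub_pos.2 (ht _ (by omega)))

theorem valueRatioOne_pos (hq0 : 0 < q) (hα0 : 0 < α) {n : ℕ} (hβ : β * q ^ (n + 1) < 1)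
    (ht : ∀ j, 2 ≤ j → α * β * q ^ j < 1) : 0 < valueRatioOne q α β n :=
  div_pos (mul_pos (mul_pos (mul_pos hα0 (pow_pos hq0 _)) (sub_pos.2 hβ)) (tailRatio_pos ht n))
    (sub_pos.2 (ht _ (by omega)))

theorem alphaConnectionCoeff_pos (hq0 : 0 < q) (hq1 : q < 1) (hα0 : 0 < α) {n : ℕ}
    (hβ : β * q ^ (n + 1) < 1) (ht : ∀ j, n + 2 ≤ j → α * β * q ^ j < 1) :
    0 < alphaConnectionCoeff q α β n :=
  div_pos
    (mul_pos (mul_pos (mul_pos hα0 (pow_pos hq0 _))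
      (sub_pos.2 (pow_lt_one₀ hq0.le hq1 n.succ_ne_zero))) (sub_pos.2 hβ))
    (mul_pos (sub_pos.2 (ht _ (by omega))) (sub_pos.2 (ht _ (by omega))))

theorem betaConnectionCoeff_pos (hq0 : 0 < q) (hq1 : q < 1) (hα0 : 0 < α) (hβ0 : 0 < β) {n : ℕ}
    (hα : α * q ^ (n + 1) < 1) (ht : ∀ j, n + 2 ≤ j → α * β * q ^ j < 1) :
    0 < betaConnectionCoeff q α β n :=
  div_pos
    (mul_pos (mul_pos (mul_pos (mul_pos hα0 hβ0) (pow_pos hq0 _))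
      (sub_pos.2 (pow_lt_one₀ hq0.le hq1 n.succ_ne_zero))) (sub_pos.2 hα))
    (mul_pos (sub_pos.2 (ht _ (by omega))) (sub_pos.2 (ht _ (by omega))))

end Positivity

section LittleQJacobiZeros

variable {q α β : ℝ} (hq0 : 0 < q) (hq1 : q < 1)
include hq0 hq1

theorem pow_succ_ne_one (j : ℕ) : q ^ (j + 1) ≠ 1 := (pow_lt_one₀ hq0.le hq1 j.succ_ne_zero).ne

section Sign

variable (hα1 : α * q < 1) (ht : ∀ j, 2 ≤ j → α * β * q ^ j < 1)
include hα1 ht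

theorem eval_zero_littleQJacobi_sign (n : ℕ) : 0 < (-1) ^ n * (littleQJacobi q α β n).eval 0 := by
  induction n with
  | zero => simp [littleQJacobi_zero]
  | succ n ih =>
    have hα := mul_pow_succ_lt_one hq0 hq1.le hα1
    rw [eval_zero_littleQJacobi_succ (fun j hj => (ht j hj).ne) hq0.ne'
      (pow_succ_ne_one hq0 hq1) fun j => (hα j).ne]
    have hpos := mul_pos (valueRatioZero_pos hq0 (hα n) ht) ih
    rw [pow_succ]
    linarith

theorem eval_one_littleQJacobi_pos (hα0 : 0 < α) (hβ1 : β * q < 1) (n : ℕ) :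
    0 < (littleQJacobi q α β n).eval 1 := by
  induction n with
  | zero => simp [littleQJacobi_zero]
  | succ n ih =>
    rw [eval_one_littleQJacobi_succ (fun j hj => (ht j hj).ne) hq0.ne'
      (pow_succ_ne_one hq0 hq1) fun j => (mul_pow_succ_lt_one hq0 hq1.le hα1 j).ne]
    exact mul_pos (valueRatioOne_pos hq0 hα0 (mul_pow_succ_lt_one hq0 hq1.le hβ1 n) ht) ih

end Sign

theorem mul_mul_pow_lt_one (hα0 : 0 < α) (hα1 : α * q < 1) (hβ1 : β * q < 1) {j : ℕ} (hj : 2 ≤ j) :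
    α * β * q ^ j < 1 := by
  obtain ⟨k, rfl⟩ := Nat.exists_eq_add_of_le hj
  rw [pow_add, ← mul_assoc]
  refine mul_pow_lt_one hq0 hq1.le ?_ k
  calc
    α * β * q ^ 2 = α * q * (β * q) := by ring
    _ < α * q * 1 := mul_lt_mul_of_pos_left hβ1 (mul_pos hα0 hq0)
    _ < 1 := by rwa [mul_one]

theorem monic_littleQJacobi_of_mul_lt_one (hα0 : 0 < α) (hα1 : α * q < 1) (hβ1 : β * q < 1)
    (n : ℕ) : (littleQJacobi q α β n).Monic :=
  monic_littleQJacobi hq0.ne' (pow_succ_ne_one hq0 hq1)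
    (fun j => (mul_pow_succ_lt_one hq0 hq1.le hα1 j).ne) fun _ hj =>
      (mul_mul_pow_lt_one hq0 hq1 hα0 hα1 hβ1 (by have := hj.1; have := hj.2; omega)).ne

theorem exists_interlacing_zeros_littleQJacobi (hα0 : 0 < α) (hα1 : α * q < 1) (hβ1 : β * q < 1)
    (n : ℕ) :
    ∃ x w, AreOrderedZeros (littleQJacobi q α β (n + 1)) (n + 1) x ∧
      AreOrderedZeros (littleQJacobi q α β n) n w ∧ Interlaces n x w ∧ 0 < x 1 ∧ x (n + 1) < 1 := by
  have hα := mul_pow_succ_lt_one hq0 hq1.le hα1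
  have ht : ∀ j, 2 ≤ j → α * β * q ^ j < 1 := fun j => mul_mul_pow_lt_one hq0 hq1 hα0 hα1 hβ1
  have hq := pow_succ_ne_one hq0 hq1
  have hα' : ∀ j, α * q ^ (j + 1) ≠ 1 := fun j => (hα j).ne
  refine exists_interlacing_zeros_of_recurrence
    (monic_littleQJacobi_of_mul_lt_one hq0 hq1 hα0 hα1 hβ1)
    (fun n => natDegree_littleQJacobi hq0.ne' hq hα' fun j hj =>
      (ht j (by have := hj.1; have := hj.2; omega)).ne)
    (fun n => mul_pos (valueRatioZero_pos hq0 (hα n) ht) (alphaConnectionCoeff_pos hq0 hq1 hα0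
      (mul_pow_succ_lt_one hq0 hq1.le hβ1 n) fun j hj => ht j (by omega)))
    (littleQJacobi_add_two (fun j hj => (ht j hj).ne) hq0.ne' hq hα')
    (eval_zero_littleQJacobi_sign hq0 hq1 hα1 ht)
    (eval_one_littleQJacobi_pos hq0 hq1 hα1 ht hα0 hβ1) n

theorem exists_interlacing_zeros_littleQJacobi_of_one_lt_alpha_mul {n : ℕ} {x w : ℕ → ℝ}
    (hα : 1 < α * q) (hα' : α * q * q < 1) (hβ : β * q < 1)
    (ht : ∀ j, n + 2 ≤ j → α * β * q ^ j < 1)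
    (hx : AreOrderedZeros (littleQJacobi q (α * q) β (n + 1)) (n + 1) x)
    (hw : AreOrderedZeros (littleQJacobi q (α * q) β n) n w) (hxw : Interlaces n x w)
    (hx0 : 0 < x 1) :
    ∃ y, AreOrderedZeros (littleQJacobi q α β (n + 1)) (n + 1) y ∧ y 1 < 0 ∧ Interlaces n y w ∧
      ∀ j ∈ Set.Icc 1 (n + 1), y j < x j := by
  have hq := pow_succ_ne_one hq0 hq1
  have hα0 : 0 < α := pos_of_mul_pos_left (one_pos.trans hα) hq0.le
  have hαne : ∀ j, α * q ^ (j + 1) ≠ 1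
    | 0 => by simpa using hα.ne'
    | j + 1 => by
      rw [pow_succ', ← mul_assoc]
      exact (mul_pow_succ_lt_one hq0 hq1.le hα' j).ne
  have hαne' : ∀ j, α * q * q ^ (j + 1) ≠ 1 := fun j => (mul_pow_succ_lt_one hq0 hq1.le hα' j).ne
  have ht' : ∀ j, 2 ≤ j → α * q * β * q ^ j < 1 := fun j =>
    mul_mul_pow_lt_one hq0 hq1 (one_pos.trans hα) hα' hβ
  have hmonic := monic_littleQJacobi_of_mul_lt_one hq0 hq1 (one_pos.trans hα) hα' hβ
  have hconnection := littleQJacobi_eq_add_alphaConnectionCoeff_mul hq0.ne' hq hαne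
    fun j hj => (ht j hj).ne
  have hlt := hx.natDegree_lt hw
  obtain ⟨y, hy, hyw⟩ := exists_interlacing_zeros_add_C_mul hx (hmonic _) hw hxw
    (alphaConnectionCoeff q α β n)
  refine ⟨y, hconnection ▸ hy, ?_, hyw, fun j hj => ?_⟩
  · have hu : 0 < n → 0 < y 2 := fun hn =>
      hx0.trans ((hxw 1 ⟨le_rfl, hn⟩).1.trans (hyw 1 ⟨le_rfl, hn⟩).2)
    refine (hy.lt_iff_eval_pos (monic_add_C_mul (hmonic _) _ hlt) n.zero_le (by simp) hu).2 ?_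
    have hdiff : 0 < alphaConnectionCoeff q α β n - valueRatioZero q (α * q) β n := by
      rw [alphaConnectionCoeff_sub_valueRatioZero fun j hj => (ht j hj).ne]
      exact div_pos (mul_pos (pow_pos hq0 n) (sub_pos.2 hα)) (sub_pos.2 (ht _ (by omega)))
    have hpos := mul_pos hdiff (eval_zero_littleQJacobi_sign hq0 hq1 hα' ht' n)
    rw [add_zero, eval_add, eval_mul, eval_C,
      eval_zero_littleQJacobi_succ (fun j hj => (ht' j hj).ne) hq0.ne' hq hαne']
    linarith
  · exact (zeros_add_C_mul_lt_iff hx (hmonic _) hw (hmonic _) hxw hy hyw hj).1.2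
      (alphaConnectionCoeff_pos hq0 hq1 hα0 (mul_pow_succ_lt_one hq0 hq1.le hβ n) ht)

theorem exists_interlacing_zeros_littleQJacobi_of_one_lt_beta_mul {n : ℕ} {x w : ℕ → ℝ}
    (hα0 : 0 < α) (hα : α * q < 1) (hβ : 1 < β * q) (hβ' : β * q * q < 1)
    (ht : ∀ j, n + 2 ≤ j → α * β * q ^ j < 1)
    (hx : AreOrderedZeros (littleQJacobi q α (β * q) (n + 1)) (n + 1) x)
    (hw : AreOrderedZeros (littleQJacobi q α (β * q) n) n w) (hxw : Interlaces n x w)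
    (hx1 : x (n + 1) < 1) :
    ∃ z, AreOrderedZeros (littleQJacobi q α β (n + 1)) (n + 1) z ∧ 1 < z (n + 1) ∧
      Interlaces n z w ∧ ∀ j ∈ Set.Icc 1 (n + 1), x j < z j := by
  have hq := pow_succ_ne_one hq0 hq1
  have hβ0 : 0 < β := pos_of_mul_pos_left (one_pos.trans hβ) hq0.le
  have hαlt := mul_pow_succ_lt_one hq0 hq1.le hα
  have hαne : ∀ j, α * q ^ (j + 1) ≠ 1 := fun j => (hαlt j).ne
  have ht' : ∀ j, 2 ≤ j → α * (β * q) * q ^ j < 1 := fun j =>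
    mul_mul_pow_lt_one hq0 hq1 hα0 hα hβ'
  have hmonic := monic_littleQJacobi_of_mul_lt_one hq0 hq1 hα0 hα hβ'
  have hconnection := littleQJacobi_eq_add_neg_betaConnectionCoeff_mul hq0.ne' hq hαne
    fun j hj => (ht j hj).ne
  have hlt := hx.natDegree_lt hw
  obtain ⟨z, hz, hzw⟩ := exists_interlacing_zeros_add_C_mul hx (hmonic _) hw hxw
    (-betaConnectionCoeff q α β n)
  refine ⟨z, hconnection ▸ hz, ?_, hzw, fun j hj => ?_⟩
  · have hl : 1 ≤ n → z n < 1 := fun hn =>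
      (hzw n ⟨hn, le_rfl⟩).1.trans ((hxw n ⟨hn, le_rfl⟩).2.trans hx1)
    refine (hz.gt_iff_eval_neg (monic_add_C_mul (hmonic _) _ hlt) le_rfl hl (by simp)).2 ?_
    have hdiff : valueRatioOne q α (β * q) n - betaConnectionCoeff q α β n < 0 := by
      rw [valueRatioOne_sub_betaConnectionCoeff fun j hj => (ht j hj).ne]
      exact div_neg_of_neg_of_pos (mul_neg_of_pos_of_neg (mul_pos hα0 (pow_pos hq0 _))
        (sub_neg.2 hβ)) (sub_pos.2 (ht _ (by omega)))
    have hneg := mul_neg_of_neg_of_pos hdiff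
      (eval_one_littleQJacobi_pos hq0 hq1 hα ht' hα0 hβ' n)
    rw [Even.neg_one_pow ⟨n, rfl⟩, one_mul, eval_add, eval_mul, eval_C,
      eval_one_littleQJacobi_succ (fun j hj => (ht' j hj).ne) hq0.ne' hq hαne]
    linarith
  · exact (zeros_add_C_mul_lt_iff hx (hmonic _) hw (hmonic _) hxw hz hzw hj).2.2
      (neg_neg_of_pos (betaConnectionCoeff_pos hq0 hq1 hα0 hβ0 (hαlt n) ht))

end LittleQJacobiZeros

theorem theorem2p10_general (q α β : ℝ) (hq0 : 0 < q) (hq1 : q < 1)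
    (hα0 : 0 < α * q) (hα1 : α * q < 1) (hβ1 : β * q < 1)
    (n : ℕ) (hn : 1 ≤ n) (hn1 : n = 1 → α * β * q < 1) :
    ∃ x w : ℕ → ℝ,
      AreOrderedZeros (littleQJacobi q α β n) n x ∧
      AreOrderedZeros (littleQJacobi q α β (n - 1)) (n - 1) w ∧
      (1 < α → ∃ y : ℕ → ℝ, AreOrderedZeros (littleQJacobi q (α / q) β n) n y ∧
        y 1 < 0 ∧ 0 < x 1 ∧
        (∀ j ∈ Set.Icc 1 (n - 1), x j < w j ∧ w j < y (j + 1)) ∧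
        (∀ j ∈ Set.Icc 1 n, y j < x j) ∧
        x n < 1) ∧
      (1 < β → ∃ z : ℕ → ℝ, AreOrderedZeros (littleQJacobi q α (β / q) n) n z ∧
        0 < x 1 ∧
        (∀ j ∈ Set.Icc 1 n, x j < z j) ∧
        (∀ j ∈ Set.Icc 1 (n - 1), z j < w j ∧ w j < x (j + 1)) ∧
        x n < 1 ∧ 1 < z n) := by
  obtain ⟨n, rfl⟩ := Nat.exists_eq_add_of_le' hn
  have hα : 0 < α := pos_of_mul_pos_left hα0 hq0.le
  have hαq : α / q * q = α := div_mul_cancel₀ α hq0.ne'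
  have hβq : β / q * q = β := div_mul_cancel₀ β hq0.ne'
  have ht : ∀ t, t * q = α * β → ∀ j, n + 2 ≤ j → t * q ^ j < 1 := by
    intro t ht j hj
    obtain ⟨i, rfl⟩ := Nat.exists_eq_add_of_le' (show 1 ≤ j by omega)
    rw [pow_succ', ← mul_assoc, ht]
    rcases (show 1 ≤ i by omega).eq_or_lt with rfl | hi
    · simpa using hn1 (by omega)
    · exact mul_mul_pow_lt_one hq0 hq1 hα hα1 hβ1 hi
  obtain ⟨x, w, hx, hw, hxw, hx0, hx1⟩ :=
    exists_interlacing_zeros_littleQJacobi hq0 hq1 hα hα1 hβ1 n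
  refine ⟨x, w, hx, hw, fun hα' => ?_, fun hβ' => ?_⟩
  · rw [← hαq] at hx hw hα' hα1
    obtain ⟨y, hy, hy0, hyw, hyx⟩ := exists_interlacing_zeros_littleQJacobi_of_one_lt_alpha_mul
      hq0 hq1 hα' hα1 hβ1 (ht _ (by rw [mul_right_comm, hαq])) hx hw hxw hx0
    exact ⟨y, hy, hy0, hx0, fun j hj => ⟨(hxw j hj).1, (hyw j hj).2⟩, hyx, hx1⟩
  · rw [← hβq] at hx hw hβ' hβ1
    obtain ⟨z, hz, hz1, hzw, hxz⟩ := exists_interlacing_zeros_littleQJacobi_of_one_lt_beta_mul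
      hq0 hq1 hα hα1 hβ' hβ1 (ht _ (by rw [mul_assoc, hβq])) hx hw hxw hx1
    exact ⟨z, hz, hx0, hxz, fun j hj => ⟨(hzw j hj).1, (hxw j hj).2⟩, hx1, hz1⟩

theorem theorem2p10 (q α β : ℝ) (hq0 : 0 < q) (hq1 : q < 1)
    (hα0 : 0 < α * q) (hα1 : α * q < 1) (hβ0 : 0 < β * q) (hβ1 : β * q < 1)
    (n : ℕ) (hn : 1 ≤ n) (hn1 : n = 1 → α * β * q < 1) :
    ∃ x w : ℕ → ℝ,
      AreOrderedZeros (littleQJacobi q α β n) n x ∧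
      AreOrderedZeros (littleQJacobi q α β (n - 1)) (n - 1) w ∧
      (1 < α → ∃ y : ℕ → ℝ, AreOrderedZeros (littleQJacobi q (α / q) β n) n y ∧
        y 1 < 0 ∧ 0 < x 1 ∧
        (∀ j ∈ Set.Icc 1 (n - 1), x j < w j ∧ w j < y (j + 1)) ∧
        (∀ j ∈ Set.Icc 1 n, y j < x j) ∧
        x n < 1) ∧
      (1 < β → ∃ z : ℕ → ℝ, AreOrderedZeros (littleQJacobi q α (β / q) n) n z ∧
        0 < x 1 ∧
        (∀ j ∈ Set.Icc 1 n, x j < z j) ∧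
        (∀ j ∈ Set.Icc 1 (n - 1), z j < w j ∧ w j < x (j + 1)) ∧
        x n < 1 ∧ 1 < z n) :=
  theorem2p10_general q α β hq0 hq1 hα0 hα1 hβ1 n hn hn1
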